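/- Let $L$ be a (one-sorted) classical first-order signature. Regard $L$ as a $1$-bounded metric signature by giving every function and predicate symbol the modulus of uniform continuity $\Delta(\epsilon)=\epsilon$. A metric $L$-structure is then a nonempty complete metric space of diameter at most $1$, together with an interpretation of each $n$-ary function symbol as a map $A^n\to A$ and of each $n$-ary predicate symbol as a map $A^n\to[0,1]$, such that every such interpretation $g$ satisfies: for all $\epsilon\in(0,1]$, if $\max_i d(a_i,b_i)<\Delta(\epsilon)$, then $g(a)$ and $g(b)$ are at distance at most $\epsilon$. The sentences of continuous logic are built from the atomic formulas $d(t_1,t_2)$ and $P(t_1,\dots,t_n)$ using all continuous functions $[0,1]^k\to[0,1]$ as connectives and $\sup_x$, $\inf_x$ as quantifiers; $\sigma^A\in[0,1]$ denotes the value of the sentence $\sigma$ in $A$. A metric $L$-structure is called finite (resp. compact) if its underlying metric space is finite (resp. compact). A metric $L$-structure $M$ is - pseudofinite (resp. pseudocompact) if $\sigma^M=0$ for every continuous $L$-sentence $\sigma$ such that $\sigma^A=0$ for all finite (resp. compact) metric $L$-structures $A$; - strongly pseudofinite (resp. strongly pseudocompact) if for every continuous $L$-sentence $\sigma$ with $\sigma^M=0$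 there is a finite (resp. compact) metric $L$-structure $A$ with $\sigma^A=0$. A nonempty classical $L$-structure $M$ is classically pseudofinite if every first-order $L$-sentence true in $M$ is true in some finite nonempty classical $L$-structure. It is regarded as a metric $L$-structure by means of the discrete metric ($d(a,b)=1$ for $a\neq b$), each predicate taking the value $0$ where it is true and $1$ where it is false. **Theorem.** Let $M$ be a nonempty classical $L$-structure. Then the following are equivalent: 1. $M$ is classically pseudofinite; 2. $M$, as a metric $L$-structure, is pseudofinite; 3. $M$, as a metric $L$-structure, is strongly pseudofinite; 4. $M$, as a metric $L$-structure, is pseudocompact; 5. $M$, as a metric $L$-structure, is strongly pseudocompact. -/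

import Mathlib

open FirstOrder Set

universe u v w x

/-- A (one-sorted, 1-bounded) metric signature: function and predicate symbols with finite arities,
together with a modulus of uniform continuity `(0,1] → (0,1]` for each symbol. -/
structure MetricSignature extends FirstOrder.Language.{u, v} where
  /-- the modulus attached to a function symbol -/
  funModulus : ∀ {n : ℕ}, Functions n → Ioc (0 : ℝ) 1 → Ioc (0 : ℝ) 1
  /-- the modulus attached to a predicate symbol -/
  relModulus : ∀ {n : ℕ}, Relations n → Ioc (0 : ℝ) 1 → Ioc (0 : ℝ) 1

/-- `Δ` is a modulus of uniform continuity of `f`. -/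
def IsModulus {X Y : Type*} [PseudoMetricSpace X] [PseudoMetricSpace Y]
    (Δ : Ioc (0 : ℝ) 1 → Ioc (0 : ℝ) 1) (f : X → Y) : Prop :=
  ∀ ε : Ioc (0 : ℝ) 1, ∀ a b : X, dist a b < (Δ ε : ℝ) → dist (f a) (f b) ≤ (ε : ℝ)

/-- A metric structure for the signature `S`: a nonempty complete metric space of diameter at most
`1`, with an interpretation of each symbol that respects its modulus. The power `Fin n → carrier`
carries the maximum metric, and predicates take values in `[0,1]`. -/
structure MetricStructure (S : MetricSignature.{u, v}) where
  carrier : Type w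
  [metricSpace : MetricSpace carrier]
  [completeSpace : CompleteSpace carrier]
  [nonempty : Nonempty carrier]
  dist_le_one : ∀ a b : carrier, dist a b ≤ 1
  funMap : ∀ {n : ℕ}, S.Functions n → (Fin n → carrier) → carrier
  relMap : ∀ {n : ℕ}, S.Relations n → (Fin n → carrier) → unitInterval
  funMap_modulus : ∀ {n : ℕ} (f : S.Functions n), IsModulus (S.funModulus f) (funMap f)
  relMap_modulus : ∀ {n : ℕ} (R : S.Relations n), IsModulus (S.relModulus R) (relMap R)

attribute [instance] MetricStructure.metricSpace MetricStructure.completeSpace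
  MetricStructure.nonempty

/-- Formulas of continuous logic over `S`, with free variables indexed by `α` and by `Fin n`
(the latter may be quantified, the last one first). Connectives are all continuous functions
`[0,1]^k → [0,1]`; quantifiers are `sup` and `inf`. -/
inductive ContFormula (S : MetricSignature.{u, v}) (α : Type x) : ℕ → Type (max u v x)
  | dist {n : ℕ} (t₁ t₂ : S.Term (α ⊕ Fin n)) : ContFormula S α n
  | rel {n m : ℕ} (R : S.Relations m) (ts : Fin m → S.Term (α ⊕ Fin n)) : ContFormula S α n
  | conn {n k : ℕ} (c : C(Fin k → unitInterval, unitInterval)) (φ : Fin k → ContFormula S α n) : ContFormula S α n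
  | sup {n : ℕ} (φ : ContFormula S α (n + 1)) : ContFormula S α n
  | inf {n : ℕ} (φ : ContFormula S α (n + 1)) : ContFormula S α n

/-- Sentences of continuous logic: formulas without free variables. -/
abbrev ContSentence (S : MetricSignature.{u, v}) : Type (max u v) :=
  ContFormula S Empty 0

namespace MetricStructure

variable {S : MetricSignature.{u, v}}

/-- The value of a term in a metric structure, under an assignment of its variables. -/
def termValue (A : MetricStructure.{u, v, w} S) {β : Type x} (e : β → A.carrier) :
    S.Term β → A.carrier
  | .var i => e i
  | .func f ts => A.funMap f fun i => A.termValue e (ts i)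

/-- The value in `[0,1]` of a continuous formula in a metric structure. -/
noncomputable def value (A : MetricStructure.{u, v, w} S) {α : Type x} :
    ∀ {n : ℕ}, ContFormula S α n → (α → A.carrier) → (Fin n → A.carrier) → unitInterval
  | _, .dist t₁ t₂, e, a =>
      ⟨Dist.dist (A.termValue (Sum.elim e a) t₁) (A.termValue (Sum.elim e a) t₂),
        dist_nonneg, A.dist_le_one _ _⟩
  | _, .rel R ts, e, a => A.relMap R fun i => A.termValue (Sum.elim e a) (ts i)
  | _, .conn c φ, e, a => c fun i => A.value (φ i) e a
  | _, .sup φ, e, a =>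
      ⟨⨆ b : A.carrier, (A.value φ e (Fin.snoc a b) : ℝ),
        Real.iSup_nonneg fun b => (A.value φ e (Fin.snoc a b)).2.1,
        Real.iSup_le (fun b => (A.value φ e (Fin.snoc a b)).2.2) zero_le_one⟩
  | _, .inf φ, e, a =>
      ⟨⨅ b : A.carrier, (A.value φ e (Fin.snoc a b) : ℝ),
        Real.iInf_nonneg fun b => (A.value φ e (Fin.snoc a b)).2.1,
        (ciInf_le ⟨0, by rintro _ ⟨b, rfl⟩; exact (A.value φ e (Fin.snoc a b)).2.1⟩
          (Classical.arbitrary A.carrier)).trans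
          (A.value φ e (Fin.snoc a (Classical.arbitrary A.carrier))).2.2⟩

/-- The value `σ^A` of a sentence `σ` in a metric structure `A`. -/
noncomputable def sentenceValue (A : MetricStructure.{u, v, w} S) (σ : ContSentence S) : unitInterval :=
  A.value σ Empty.elim Fin.elim0

/-- A metric structure is finite if its underlying set is finite. -/
def IsFinite (A : MetricStructure.{u, v, w} S) : Prop := Finite A.carrier

/-- A metric structure is compact if its underlying metric space is compact. -/
def IsCompact (A : MetricStructure.{u, v, w} S) : Prop := CompactSpace A.carrier

/-- Every sentence with value `0` in all finite structures has value `0` in `M`. -/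
def Pseudofinite (M : MetricStructure.{u, v, w} S) : Prop :=
  ∀ σ : ContSentence S,
    (∀ A : MetricStructure.{u, v, w} S, A.IsFinite → A.sentenceValue σ = 0) →
      M.sentenceValue σ = 0

/-- Every sentence with value `0` in all compact structures has value `0` in `M`. -/
def Pseudocompact (M : MetricStructure.{u, v, w} S) : Prop :=
  ∀ σ : ContSentence S,
    (∀ A : MetricStructure.{u, v, w} S, A.IsCompact → A.sentenceValue σ = 0) →
      M.sentenceValue σ = 0

/-- Every sentence with value `0` in `M` has value `0` in some finite structure. -/
def StronglyPseudofinite (M : MetricStructure.{u, v, w} S) : Prop :=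
  ∀ σ : ContSentence S, M.sentenceValue σ = 0 →
    ∃ A : MetricStructure.{u, v, w} S, A.IsFinite ∧ A.sentenceValue σ = 0

/-- Every sentence with value `0` in `M` has value `0` in some compact structure. -/
def StronglyPseudocompact (M : MetricStructure.{u, v, w} S) : Prop :=
  ∀ σ : ContSentence S, M.sentenceValue σ = 0 →
    ∃ A : MetricStructure.{u, v, w} S, A.IsCompact ∧ A.sentenceValue σ = 0

end MetricStructure

/-- A classical structure `M` is pseudofinite if every classical first-order sentence true in `M`
is true in some finite (nonempty) structure. -/
def ClassicallyPseudofinite (L : FirstOrder.Language.{u, v}) (M : Type w) [L.Structure M] : Prop :=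
  ∀ σ : L.Sentence, M ⊨ σ →
    ∃ (B : Type w) (_ : L.Structure B), Nonempty B ∧ Finite B ∧ B ⊨ σ

/-- A classical signature regarded as a metric signature: every symbol gets the modulus
`Δ(ε) = ε`. -/
def FirstOrder.Language.toMetricSignature (L : FirstOrder.Language.{u, v}) : MetricSignature.{u, v} where
  toLanguage := L
  funModulus _ := id
  relModulus _ := id

open Classical in
/-- The discrete metric: distinct points have distance `1`. -/
noncomputable abbrev discreteMetric (M : Type w) : MetricSpace M where
  dist a b := if a = b then 0 else 1
  dist_self a := by simp
  dist_comm a b := by simp [eq_comm]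
  dist_triangle a b c := by
    by_cases h₁ : a = b <;> by_cases h₂ : b = c <;> by_cases h₃ : a = c <;> simp_all
  eq_of_dist_eq_zero {a b} h := by
    by_contra hab
    simp [hab] at h

open Classical in
/-- A nonempty classical `L`-structure regarded as a metric structure: the metric is discrete, and a
predicate has value `0` where it is true and `1` where it is false. -/
noncomputable def MetricStructure.ofClassical (L : FirstOrder.Language.{u, v}) (M : Type w) [L.Structure M]
    [Nonempty M] : MetricStructure.{u, v, w} L.toMetricSignature :=
  letI : MetricSpace M := discreteMetric M
  have key : ∀ a b : M, a ≠ b → dist a b = 1 := fun _ _ h => if_neg h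
  have pi_key : ∀ {n : ℕ} (a b : Fin n → M), dist a b < 1 → a = b := fun a b h =>
    funext fun i => by
      by_contra hi
      exact absurd ((key _ _ hi).symm.le.trans (dist_le_pi_dist a b i)) (not_le.mpr h)
  { carrier := M
    metricSpace := discreteMetric M
    completeSpace := by
      refine Metric.complete_of_cauchySeq_tendsto fun s hs => ?_
      obtain ⟨N, hN⟩ := Metric.cauchySeq_iff'.mp hs 1 one_pos
      refine ⟨s N, tendsto_const_nhds.congr' ?_⟩
      filter_upwards [Filter.eventually_ge_atTop N] with n hn
      by_contra h
      exact absurd (hN n hn) (by rw [key _ _ (Ne.symm h)]; exact lt_irrefl 1)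
    nonempty := inferInstance
    dist_le_one := fun a b => by
      by_cases h : a = b
      · simp [h]
      · exact (key a b h).le
    funMap := fun {_} f a => FirstOrder.Language.Structure.funMap (L := L) f a
    relMap := fun {_} R a => if FirstOrder.Language.Structure.RelMap (L := L) R a then 0 else 1
    funMap_modulus := fun f ε a b h => by
      rw [pi_key a b (h.trans_le ε.2.2), dist_self]
      exact ε.2.1.le
    relMap_modulus := fun R ε a b h => by
      rw [pi_key a b (h.trans_le ε.2.2), dist_self]
      exact ε.2.1.le }

/-! The implications among 2–5 are formal: finite spaces are compact, and the strong notions give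
the weak ones on replacing `σ` by `|σ - r|`. The content lies in 1 → 3 and 4 → 1.

For 1 → 3, a continuous formula takes only finitely many values on discrete structures, uniformly in
the structure, and each condition "value `= r`" is first-order (`exists_definable_value_eq`). So
"`σ` has value `0`" is a classical sentence, and a finite classical model of it, with the discrete
metric, is the required witness.

For 4 → 1, let `σ` be a classical sentence true in `M`. The maximum of `distFuzziness`,
`σ.atomFuzziness` and `σ.toCont` vanishes in `M`, hence is below `1/8` in some compact `A`.
Distances in `A` are then within `1/8` of `0` or `1`, so "distance at most `1/8`" is an equivalence
relation, with finitely many classes by compactness. The moduli make the quotient a classical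
structure (`exists_finite_quotient`), and truth there agrees with values in `A` up to `1/8`
(`value_toCont_of_approx`), so `σ` holds in it. -/

open FirstOrder.Language

/-! ### Values of connectives and quantifiers -/

namespace ContFormula

variable {S : MetricSignature.{u, v}} {α : Type x} {n : ℕ}

/-- The unary connective given by a continuous real function truncated to `[0,1]`. -/
noncomputable def truncate (g : C(ℝ, ℝ)) (φ : ContFormula S α n) : ContFormula S α n :=
  .conn (k := 1)
    ⟨fun t => projIcc 0 1 zero_le_one (g (t 0)), by
      exact continuous_projIcc.comp (g.continuous.comp (by fun_prop))⟩ fun _ => φ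

/-- The maximum of two formulas. -/
noncomputable def max (φ ψ : ContFormula S α n) : ContFormula S α n :=
  .conn (k := 2) ⟨fun t => t 0 ⊔ t 1, by fun_prop⟩ ![φ, ψ]

/-- The implication connective `min (1 - φ) ψ`. -/
noncomputable def imp (φ ψ : ContFormula S α n) : ContFormula S α n :=
  .conn (k := 2) ⟨fun t => unitInterval.symm (t 0) ⊓ t 1, by fun_prop⟩ ![φ, ψ]

/-- The formula `min φ (1 - φ)`, which vanishes exactly when `φ` takes a value in `{0, 1}`. -/
noncomputable def fuzziness (φ : ContFormula S α n) : ContFormula S α n :=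
  .conn (k := 1) ⟨fun t => t 0 ⊓ unitInterval.symm (t 0), by fun_prop⟩ fun _ => φ

/-- A constant formula. -/
noncomputable def const (r : unitInterval) : ContFormula S α n :=
  .conn (k := 0) (ContinuousMap.const _ r) Fin.elim0

end ContFormula

namespace MetricStructure

section Values

variable {S : MetricSignature.{u, v}} (A : MetricStructure.{u, v, w} S) {α : Type x} {n : ℕ}
  (e : α → A.carrier) (a : Fin n → A.carrier)

/-- Lets closed conditions such as `σ = r` or `ε ≤ σ` be expressed as the vanishing of a sentence.
-/
theorem value_truncate_eq_zero (g : C(ℝ, ℝ)) (φ : ContFormula S α n) :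
    A.value (φ.truncate g) e a = 0 ↔ g (A.value φ e a) ≤ 0 :=
  projIcc_eq_left zero_lt_one

theorem coe_value_max (φ ψ : ContFormula S α n) :
    (A.value (φ.max ψ) e a : ℝ) = Max.max (A.value φ e a : ℝ) (A.value ψ e a) :=
  Monotone.map_max (f := ((↑) : unitInterval → ℝ)) fun _ _ h => h

theorem coe_value_imp (φ ψ : ContFormula S α n) :
    (A.value (φ.imp ψ) e a : ℝ) = min (1 - (A.value φ e a : ℝ)) (A.value ψ e a) :=
  Monotone.map_min (f := ((↑) : unitInterval → ℝ)) fun _ _ h => h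

theorem coe_value_fuzziness (φ : ContFormula S α n) :
    (A.value φ.fuzziness e a : ℝ) = min (A.value φ e a : ℝ) (1 - (A.value φ e a : ℝ)) :=
  Monotone.map_min (f := ((↑) : unitInterval → ℝ)) fun _ _ h => h

theorem value_max_eq_zero {φ ψ : ContFormula S α n} (hφ : A.value φ e a = 0)
    (hψ : A.value ψ e a = 0) : A.value (φ.max ψ) e a = 0 :=
  Subtype.ext ((A.coe_value_max e a φ ψ).trans (by simp [hφ, hψ]))

theorem value_fuzziness_eq_zero {φ : ContFormula S α n}
    (h : A.value φ e a = 0 ∨ A.value φ e a = 1) : A.value φ.fuzziness e a = 0 :=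
  Subtype.ext ((A.coe_value_fuzziness e a φ).trans (by rcases h with h | h <;> simp [h]))

theorem value_const (r : unitInterval) :
    A.value (.const r : ContFormula S α n) e a = r := rfl

theorem value_le_value_sup (φ : ContFormula S α (n + 1)) (b : A.carrier) :
    A.value φ e (Fin.snoc a b) ≤ A.value φ.sup e a :=
  le_ciSup (f := fun b : A.carrier => (A.value φ e (Fin.snoc a b) : ℝ))
    ⟨1, by rintro _ ⟨b, rfl⟩; exact (A.value φ e (Fin.snoc a b)).2.2⟩ b

theorem value_inf_le_value (φ : ContFormula S α (n + 1)) (b : A.carrier) :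
    A.value φ.inf e a ≤ A.value φ e (Fin.snoc a b) :=
  ciInf_le (f := fun b : A.carrier => (A.value φ e (Fin.snoc a b) : ℝ))
    ⟨0, by rintro _ ⟨b, rfl⟩; exact (A.value φ e (Fin.snoc a b)).2.1⟩ b

theorem value_sup_eq_zero {φ : ContFormula S α (n + 1)}
    (h : ∀ b, A.value φ e (Fin.snoc a b) = 0) : A.value φ.sup e a = 0 := by
  apply Subtype.ext
  change (⨆ b : A.carrier, (A.value φ e (Fin.snoc a b) : ℝ)) = 0
  simp [h]

theorem value_sup_le_iff (φ : ContFormula S α (n + 1)) (r : unitInterval) :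
    A.value φ.sup e a ≤ r ↔ ∀ b, A.value φ e (Fin.snoc a b) ≤ r :=
  ⟨fun h b => (A.value_le_value_sup e a φ b).trans h, fun h => by
    change (⨆ b : A.carrier, (A.value φ e (Fin.snoc a b) : ℝ)) ≤ r
    exact ciSup_le h⟩

theorem le_value_inf_iff (φ : ContFormula S α (n + 1)) (r : unitInterval) :
    r ≤ A.value φ.inf e a ↔ ∀ b, r ≤ A.value φ e (Fin.snoc a b) :=
  ⟨fun h b => h.trans (A.value_inf_le_value e a φ b), fun h => by
    change (r : ℝ) ≤ ⨅ b : A.carrier, (A.value φ e (Fin.snoc a b) : ℝ)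
    exact le_ciInf h⟩

/-- A supremum over finitely many values is attained. -/
theorem value_sup_eq_iff (φ : ContFormula S α (n + 1)) {F : Finset unitInterval}
    (hF : ∀ b, A.value φ e (Fin.snoc a b) ∈ F) (r : unitInterval) :
    A.value φ.sup e a = r ↔
      (∃ b, A.value φ e (Fin.snoc a b) = r) ∧ ∀ b, A.value φ e (Fin.snoc a b) ≤ r := by
  have hfin : (range fun b => A.value φ e (Fin.snoc a b)).Finite :=
    F.finite_toSet.subset (by rintro _ ⟨b, rfl⟩; exact hF b)
  obtain ⟨_, ⟨b₀, rfl⟩, hb₀⟩ := exists_max_image _ id hfin (range_nonempty _)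
  have hmax : A.value φ.sup e a = A.value φ e (Fin.snoc a b₀) :=
    le_antisymm ((A.value_sup_le_iff e a φ _).2 fun b => hb₀ _ ⟨b, rfl⟩)
      (A.value_le_value_sup e a φ b₀)
  constructor
  · rintro rfl
    exact ⟨⟨b₀, hmax.symm⟩, A.value_le_value_sup e a φ⟩
  · rintro ⟨⟨b, rfl⟩, h⟩
    exact le_antisymm ((A.value_sup_le_iff e a φ _).2 h) (A.value_le_value_sup e a φ b)

/-- An infimum over finitely many values is attained. -/
theorem value_inf_eq_iff (φ : ContFormula S α (n + 1)) {F : Finset unitInterval}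
    (hF : ∀ b, A.value φ e (Fin.snoc a b) ∈ F) (r : unitInterval) :
    A.value φ.inf e a = r ↔
      (∃ b, A.value φ e (Fin.snoc a b) = r) ∧ ∀ b, r ≤ A.value φ e (Fin.snoc a b) := by
  have hfin : (range fun b => A.value φ e (Fin.snoc a b)).Finite :=
    F.finite_toSet.subset (by rintro _ ⟨b, rfl⟩; exact hF b)
  obtain ⟨_, ⟨b₀, rfl⟩, hb₀⟩ := exists_min_image _ id hfin (range_nonempty _)
  have hmin : A.value φ.inf e a = A.value φ e (Fin.snoc a b₀) :=
    le_antisymm (A.value_inf_le_value e a φ b₀)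
      ((A.le_value_inf_iff e a φ _).2 fun b => hb₀ _ ⟨b, rfl⟩)
  constructor
  · rintro rfl
    exact ⟨⟨b₀, hmin.symm⟩, A.value_inf_le_value e a φ⟩
  · rintro ⟨⟨b, rfl⟩, h⟩
    exact le_antisymm (A.value_inf_le_value e a φ b) ((A.le_value_inf_iff e a φ _).2 h)

end Values

/-! ### The general implications -/

section Implications

variable {S : MetricSignature.{u, v}} {A M : MetricStructure.{u, v, w} S}

theorem IsFinite.isCompact (h : A.IsFinite) : A.IsCompact :=
  have : Finite A.carrier := h
  inferInstanceAs (CompactSpace A.carrier)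

theorem Pseudofinite.pseudocompact (h : M.Pseudofinite) : M.Pseudocompact :=
  fun σ hσ => h σ fun A hA => hσ A hA.isCompact

theorem StronglyPseudofinite.stronglyPseudocompact (h : M.StronglyPseudofinite) :
    M.StronglyPseudocompact := fun σ hσ =>
  let ⟨A, hA, hA'⟩ := h σ hσ
  ⟨A, hA.isCompact, hA'⟩

/-- The sentence `|σ - r|` vanishes exactly where `σ` takes the value `r`. -/
theorem exists_sentenceValue_eq_zero_iff (σ : ContSentence S) (r : unitInterval) :
    ∃ τ : ContSentence S, ∀ A : MetricStructure.{u, v, w} S,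
      A.sentenceValue τ = 0 ↔ A.sentenceValue σ = r := by
  refine ⟨σ.truncate ⟨fun t => |t - r|, by fun_prop⟩, fun A => ?_⟩
  refine (A.value_truncate_eq_zero _ _ _ _).trans ?_
  change |(A.sentenceValue σ : ℝ) - r| ≤ 0 ↔ _
  rw [abs_nonpos_iff, sub_eq_zero, Subtype.ext_iff]

/-- Some finite structure gives `σ` the same value as `M` does; if `σ` vanishes in all finite
structures, that value is `0`. -/
theorem StronglyPseudofinite.pseudofinite (h : M.StronglyPseudofinite) : M.Pseudofinite := by
  intro σ hσ
  obtain ⟨τ, hτ⟩ := exists_sentenceValue_eq_zero_iff.{u, v, w} σ (M.sentenceValue σ)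
  obtain ⟨A, hA, hA'⟩ := h τ ((hτ M).2 rfl)
  exact ((hτ A).1 hA').symm.trans (hσ A hA)

theorem StronglyPseudocompact.pseudocompact (h : M.StronglyPseudocompact) :
    M.Pseudocompact := by
  intro σ hσ
  obtain ⟨τ, hτ⟩ := exists_sentenceValue_eq_zero_iff.{u, v, w} σ (M.sentenceValue σ)
  obtain ⟨A, hA, hA'⟩ := h τ ((hτ M).2 rfl)
  exact ((hτ A).1 hA').symm.trans (hσ A hA)

/-- A sentence with value `0` in a pseudocompact structure has arbitrarily small values in compact
structures. -/
theorem Pseudocompact.exists_sentenceValue_lt (h : M.Pseudocompact) {σ : ContSentence S}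
    (hσ : M.sentenceValue σ = 0) {ε : ℝ} (hε : 0 < ε) :
    ∃ A : MetricStructure.{u, v, w} S, A.IsCompact ∧ (A.sentenceValue σ : ℝ) < ε := by
  by_contra! H
  -- If `σ ≥ ε` in every compact structure, then `ε - σ`, truncated to `[0,1]`, vanishes in all of
  -- them and hence in `M`, where `σ = 0 < ε`.
  have key : ∀ A : MetricStructure.{u, v, w} S,
      A.sentenceValue (σ.truncate ⟨fun t => ε - t, by fun_prop⟩) = 0 ↔
        ε ≤ A.sentenceValue σ := fun A =>
    (A.value_truncate_eq_zero _ _ _ _).trans (sub_nonpos (a := ε))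
  have := (key M).1 (h _ fun A hA => (key A).2 (H A hA))
  rw [hσ] at this
  exact absurd this (not_le.2 hε)

end Implications

/-! ### Continuous formulas in classical structures -/

section Classical

variable {L : FirstOrder.Language.{u, v}}

theorem sentence_realize_iff {B : Type*} [L.Structure B] (σ : L.Sentence) (e : Empty → B)
    (a : Fin 0 → B) : B ⊨ σ ↔ BoundedFormula.Realize σ e a :=
  iff_of_eq (congrArg₂ (BoundedFormula.Realize σ) (Subsingleton.elim _ _) (Subsingleton.elim _ _))

/-- Serves both the identity of a classical structure and the quotient map of a compact one; terms
involve only function symbols, so nothing is asked of predicates. -/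
theorem map_termValue (A : MetricStructure.{u, v, w} L.toMetricSignature) {B : Type*}
    [L.Structure B] (q : A.carrier → B)
    (hq : ∀ {n : ℕ} (f : L.Functions n) (a : Fin n → A.carrier),
      q (A.funMap (S := L.toMetricSignature) f a) = Structure.funMap f (q ∘ a))
    {β : Type x} (e : β → A.carrier) (t : L.Term β) :
    q (A.termValue e t) = t.realize (q ∘ e) := by
  induction t with
  | var i => rfl
  | func f ts ih => exact (hq f _).trans (congrArg (Structure.funMap f) (funext ih))

theorem ofClassical_termValue (M : Type w) [L.Structure M] [Nonempty M] {β : Type x}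
    (e : β → M) (t : L.Term β) : (ofClassical L M).termValue e t = t.realize e :=
  map_termValue (ofClassical L M) (B := M) id (fun _ _ => rfl) e t

theorem ofClassical_value_dist (M : Type w) [L.Structure M] [Nonempty M] {α : Type x} {n : ℕ}
    (t₁ t₂ : L.Term (α ⊕ Fin n)) (e : α → M) (a : Fin n → M) :
    ((t₁.bdEqual t₂).Realize e a → (ofClassical L M).value (.dist t₁ t₂) e a = 0) ∧
      (¬ (t₁.bdEqual t₂).Realize e a → (ofClassical L M).value (.dist t₁ t₂) e a = 1) := by
  rw [BoundedFormula.realize_bdEqual, ← ofClassical_termValue, ← ofClassical_termValue]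
  exact ⟨fun h => Subtype.ext (if_pos h), fun h => Subtype.ext (if_neg h)⟩

theorem ofClassical_value_rel (M : Type w) [L.Structure M] [Nonempty M] {α : Type x} {n m : ℕ}
    (R : L.Relations m) (ts : Fin m → L.Term (α ⊕ Fin n)) (e : α → M) (a : Fin n → M) :
    ((R.boundedFormula ts).Realize e a →
        (ofClassical L M).value (.rel (S := L.toMetricSignature) R ts) e a = 0) ∧
      (¬ (R.boundedFormula ts).Realize e a →
        (ofClassical L M).value (.rel (S := L.toMetricSignature) R ts) e a = 1) := by
  simp only [BoundedFormula.realize_rel, ← ofClassical_termValue]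
  exact ⟨fun h => if_pos h, fun h => if_neg h⟩

/-- If a continuous formula is `0` or `1` according to a classical formula, then all conditions on its
value are definable. -/
theorem exists_definable_of_ite {α : Type x} {n : ℕ}
    (φ : ContFormula L.toMetricSignature α n) (ψ : L.BoundedFormula α n)
    (h : ∀ (B : Type w) [L.Structure B] [Nonempty B] (e : α → B) (a : Fin n → B),
      (ψ.Realize e a → (ofClassical L B).value φ e a = 0) ∧
      (¬ ψ.Realize e a → (ofClassical L B).value φ e a = 1)) :
    ∃ F : Finset unitInterval,
      (∀ (B : Type w) [L.Structure B] [Nonempty B] (e : α → B) (a : Fin n → B),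
        (ofClassical L B).value φ e a ∈ F) ∧
      ∀ r : unitInterval, ∃ θ : L.BoundedFormula α n,
        ∀ (B : Type w) [L.Structure B] [Nonempty B] (e : α → B) (a : Fin n → B),
          θ.Realize e a ↔ (ofClassical L B).value φ e a = r := by
  refine ⟨{0, 1}, fun B _ _ e a => ?_, fun r => ?_⟩
  · by_cases hψ : ψ.Realize e a
    · simp [(h B e a).1 hψ]
    · simp [(h B e a).2 hψ]
  · by_cases h0 : r = 0
    · refine ⟨ψ, fun B _ _ e a => ?_⟩
      by_cases hψ : ψ.Realize e a
      · simp [(h B e a).1 hψ, hψ, h0]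
      · simp [(h B e a).2 hψ, hψ, h0]
    · by_cases h1 : r = 1
      · refine ⟨ψ.not, fun B _ _ e a => ?_⟩
        by_cases hψ : ψ.Realize e a
        · simp [(h B e a).1 hψ, hψ, h1]
        · simp [(h B e a).2 hψ, hψ, h1]
      -- A value other than `0` and `1` never occurs.
      · refine ⟨⊥, fun B _ _ e a => ?_⟩
        by_cases hψ : ψ.Realize e a
        · simp [(h B e a).1 hψ, Ne.symm h0]
        · simp [(h B e a).2 hψ, Ne.symm h1]

/-- Over classical structures a continuous formula takes finitely many values, and each condition
on its value is expressed by a classical formula. -/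
theorem exists_definable_value_eq {α : Type x} {n : ℕ}
    (φ : ContFormula L.toMetricSignature α n) :
    ∃ F : Finset unitInterval,
      (∀ (B : Type w) [L.Structure B] [Nonempty B] (e : α → B) (a : Fin n → B),
        (ofClassical L B).value φ e a ∈ F) ∧
      ∀ r : unitInterval, ∃ θ : L.BoundedFormula α n,
        ∀ (B : Type w) [L.Structure B] [Nonempty B] (e : α → B) (a : Fin n → B),
          θ.Realize e a ↔ (ofClassical L B).value φ e a = r := by
  classical
  induction φ with
  | dist t₁ t₂ =>
    exact exists_definable_of_ite _ (Term.bdEqual (L := L) t₁ t₂)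
      fun B _ _ e a => ofClassical_value_dist (L := L) B t₁ t₂ e a
  | rel R ts =>
    exact exists_definable_of_ite _ (Relations.boundedFormula (L := L) R ts)
      fun B _ _ e a => ofClassical_value_rel (L := L) B R ts e a
  | @conn n k c φ ih =>
    choose F hF θ hθ using ih
    refine ⟨(Fintype.piFinset F).image c, fun B _ _ e a => ?_, fun r => ?_⟩
    · exact Finset.mem_image.2
        ⟨_, Fintype.mem_piFinset.2 fun i => hF i B e a, rfl⟩
    -- A finite disjunction over the possible value tuples `v` with `c v = r`.
    · refine ⟨BoundedFormula.iSup (β := {v // v ∈ (Fintype.piFinset F).filter (c · = r)})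
        fun v => BoundedFormula.iInf fun i => θ i (v.1 i), fun B _ _ e a => ?_⟩
      simp only [BoundedFormula.realize_iSup, BoundedFormula.realize_iInf, hθ]
      constructor
      · rintro ⟨⟨v, hv⟩, h⟩
        exact (congrArg c (funext h)).trans (Finset.mem_filter.1 hv).2
      · intro h
        exact ⟨⟨fun i => (ofClassical L B).value (φ i) e a, Finset.mem_filter.2
          ⟨Fintype.mem_piFinset.2 fun i => hF i B e a, h⟩⟩, fun i => rfl⟩
  | @sup n φ ih =>
    obtain ⟨F, hF, hθ⟩ := ih
    choose θ hθ using hθ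
    refine ⟨F, fun B _ _ e a => ?_, fun r => ?_⟩
    · obtain ⟨⟨b, hb⟩, -⟩ := ((ofClassical L B).value_sup_eq_iff e a φ (fun b => hF B e _) _).1 rfl
      rw [← hb]
      exact hF B e _
    -- The supremum is attained, so it equals `r` iff `r` is a value and an upper bound; "value `≤
    -- r`" is a finite disjunction over `F`.
    · refine ⟨(θ r).ex ⊓ (BoundedFormula.iSup (β := {s // s ∈ F.filter (· ≤ r)})
        fun s => θ s.1).all, fun B _ _ e a => ?_⟩
      rw [(ofClassical L B).value_sup_eq_iff e a φ (fun b => hF B e _) r]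
      simp only [BoundedFormula.realize_inf, BoundedFormula.realize_ex,
        BoundedFormula.realize_all, BoundedFormula.realize_iSup, hθ]
      refine and_congr Iff.rfl (forall_congr' fun b => ⟨?_, fun h => ?_⟩)
      · rintro ⟨⟨s, hs⟩, h⟩
        exact h.trans_le (Finset.mem_filter.1 hs).2
      · exact ⟨⟨_, Finset.mem_filter.2 ⟨hF B e _, h⟩⟩, rfl⟩
  | @inf n φ ih =>
    obtain ⟨F, hF, hθ⟩ := ih
    choose θ hθ using hθ
    refine ⟨F, fun B _ _ e a => ?_, fun r => ?_⟩
    · obtain ⟨⟨b, hb⟩, -⟩ := ((ofClassical L B).value_inf_eq_iff e a φ (fun b => hF B e _) _).1 rfl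
      rw [← hb]
      exact hF B e _
    · refine ⟨(θ r).ex ⊓ (BoundedFormula.iSup (β := {s // s ∈ F.filter (r ≤ ·)})
        fun s => θ s.1).all, fun B _ _ e a => ?_⟩
      rw [(ofClassical L B).value_inf_eq_iff e a φ (fun b => hF B e _) r]
      simp only [BoundedFormula.realize_inf, BoundedFormula.realize_ex,
        BoundedFormula.realize_all, BoundedFormula.realize_iSup, hθ]
      refine and_congr Iff.rfl (forall_congr' fun b => ⟨?_, fun h => ?_⟩)
      · rintro ⟨⟨s, hs⟩, h⟩
        exact (Finset.mem_filter.1 hs).2.trans_eq h.symm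
      · exact ⟨⟨_, Finset.mem_filter.2 ⟨hF B e _, h⟩⟩, rfl⟩

theorem _root_.ClassicallyPseudofinite.stronglyPseudofinite {M : Type w} [L.Structure M]
    [Nonempty M] (h : ClassicallyPseudofinite L M) : (ofClassical L M).StronglyPseudofinite := by
  intro σ hσ
  obtain ⟨-, -, hθ⟩ := exists_definable_value_eq.{u, v, w} σ
  obtain ⟨θ, hθ⟩ := hθ 0
  have key : ∀ (B : Type w) [L.Structure B] [Nonempty B],
      Sentence.Realize B θ ↔ (ofClassical L B).sentenceValue σ = 0 := by
    intro B _ _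
    refine Iff.trans ?_ (hθ B Empty.elim Fin.elim0)
    exact sentence_realize_iff θ _ _
  obtain ⟨B, _, _, hfin, hB⟩ := h θ ((key M).2 hσ)
  exact ⟨ofClassical L B, hfin, (key B).1 hB⟩

end Classical

end MetricStructure

/-! ### Classical formulas as continuous formulas -/

namespace FirstOrder.Language.BoundedFormula

variable {L : FirstOrder.Language.{u, v}} {α : Type x}

/-- The continuous formula obtained from a classical one, with value `0` for truth. -/
noncomputable def toCont : ∀ {n : ℕ}, L.BoundedFormula α n → ContFormula L.toMetricSignature α n
  | _, .falsum => .const 1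
  | _, .equal t₁ t₂ => .dist t₁ t₂
  | _, .rel R ts => .rel (S := L.toMetricSignature) R ts
  | _, .imp φ ψ => φ.toCont.imp ψ.toCont
  | _, .all φ => .sup φ.toCont

/-- The continuous formula measuring how far the relational atoms of a classical formula are from
being `{0, 1}`-valued. -/
noncomputable def atomFuzziness :
    ∀ {n : ℕ}, L.BoundedFormula α n → ContFormula L.toMetricSignature α n
  | _, .falsum => .const 0
  -- Equality atoms need no test here: `distFuzziness` controls the metric globally.
  | _, .equal _ _ => .const 0
  | _, .rel R ts => .fuzziness (.rel (S := L.toMetricSignature) R ts)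
  | _, .imp φ ψ => φ.atomFuzziness.max ψ.atomFuzziness
  | _, .all φ => .sup φ.atomFuzziness

end FirstOrder.Language.BoundedFormula

namespace MetricStructure

variable {L : FirstOrder.Language.{u, v}} {α : Type x} {n : ℕ}

theorem ofClassical_value_atomFuzziness (M : Type w) [L.Structure M] [Nonempty M]
    (φ : L.BoundedFormula α n) (e : α → M) (a : Fin n → M) :
    (ofClassical L M).value φ.atomFuzziness e a = 0 := by
  induction φ with
  | falsum => rfl
  | equal t₁ t₂ => rfl
  | rel R ts =>
    exact value_fuzziness_eq_zero _ _ _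
      ((Classical.em _).imp (ofClassical_value_rel M R ts e a).1 (ofClassical_value_rel M R ts e a).2)
  | imp φ ψ ihφ ihψ => exact value_max_eq_zero _ _ _ (ihφ a) (ihψ a)
  | all φ ih => exact value_sup_eq_zero _ _ _ fun b => ih _

/-- If `B` is approximated by the metric structure `A` up to `δ`, then so are the truth values of
all classical formulas whose atoms are nearly `{0, 1}`-valued in `A`. -/
theorem value_toCont_of_approx (A : MetricStructure.{u, v, w} L.toMetricSignature) {B : Type*}
    [L.Structure B] (q : A.carrier → B) (hsurj : Function.Surjective q) {δ : ℝ} (hδ : 0 ≤ δ)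
    (hfun : ∀ {n : ℕ} (f : L.Functions n) (a : Fin n → A.carrier),
      q (A.funMap (S := L.toMetricSignature) f a) = Structure.funMap f (q ∘ a))
    (heq : ∀ a b, q a = q b → dist a b ≤ δ) (hne : ∀ a b, q a ≠ q b → 1 - δ ≤ dist a b)
    (hrel : ∀ {n : ℕ} (R : L.Relations n) (a : Fin n → A.carrier),
      ((A.relMap (S := L.toMetricSignature) R a : ℝ) ≤ δ →
        Structure.RelMap R (q ∘ a)) ∧
      (1 - δ ≤ (A.relMap (S := L.toMetricSignature) R a : ℝ) →
        ¬ Structure.RelMap R (q ∘ a)))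
    (φ : L.BoundedFormula α n) (e : α → A.carrier) (a : Fin n → A.carrier)
    (hφ : (A.value φ.atomFuzziness e a : ℝ) ≤ δ) :
    (φ.Realize (q ∘ e) (q ∘ a) → (A.value φ.toCont e a : ℝ) ≤ δ) ∧
      (¬ φ.Realize (q ∘ e) (q ∘ a) → 1 - δ ≤ (A.value φ.toCont e a : ℝ)) := by
  -- Errors do not accumulate: `min (1 - x) y` and suprema keep values within the same `δ` of the
  -- correct truth value.
  induction φ with
  | falsum => exact ⟨False.elim, fun _ => by simpa [BoundedFormula.toCont, value_const] using hδ⟩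
  | equal t₁ t₂ =>
    have h : (t₁.bdEqual t₂).Realize (q ∘ e) (q ∘ a) ↔
        q (A.termValue (Sum.elim e a) t₁) = q (A.termValue (Sum.elim e a) t₂) := by
      rw [BoundedFormula.realize_bdEqual, map_termValue A q hfun, map_termValue A q hfun,
        Sum.comp_elim]
    exact ⟨fun h' => heq _ _ (h.1 h'), fun h' => hne _ _ fun h'' => h' (h.2 h'')⟩
  | @rel n m R ts =>
    have h : (R.boundedFormula ts).Realize (q ∘ e) (q ∘ a) ↔
        Structure.RelMap R (q ∘ fun i => A.termValue (Sum.elim e a) (ts i)) := by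
      rw [BoundedFormula.realize_rel, ← Sum.comp_elim]
      exact iff_of_eq (congrArg _ (funext fun i => (map_termValue A q hfun _ _).symm))
    have hcases : (A.value (.rel (S := L.toMetricSignature) R ts) e a : ℝ) ≤ δ ∨
        1 - δ ≤ (A.value (.rel (S := L.toMetricSignature) R ts) e a : ℝ) := by
      have := hφ
      rw [BoundedFormula.atomFuzziness, coe_value_fuzziness, min_le_iff] at this
      exact this.imp id fun h => by linarith
    constructor
    · intro h'
      exact hcases.resolve_right fun hc => (hrel R _).2 hc (h.1 h')
    · intro h'
      exact hcases.resolve_left fun hc => h' (h.2 ((hrel R _).1 hc))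
  | imp φ ψ ihφ ihψ =>
    rw [BoundedFormula.atomFuzziness, coe_value_max, max_le_iff] at hφ
    obtain ⟨hφ₁, hφ₂⟩ := ihφ a hφ.1
    obtain ⟨hψ₁, hψ₂⟩ := ihψ a hφ.2
    rw [BoundedFormula.realize_imp, BoundedFormula.toCont, coe_value_imp, min_le_iff,
      le_min_iff]
    constructor
    · intro h
      by_cases h' : φ.Realize (q ∘ e) (q ∘ a)
      · exact .inr (hψ₁ (h h'))
      · exact .inl (by linarith [hφ₂ h'])
    · intro h
      push Not at h
      exact ⟨by linarith [hφ₁ h.1], hψ₂ h.2⟩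
  | all φ ih =>
    have hb : ∀ b, (A.value φ.atomFuzziness e (Fin.snoc a b) : ℝ) ≤ δ := fun b =>
      le_trans (A.value_le_value_sup e a φ.atomFuzziness b) hφ
    have key := fun b => ih (Fin.snoc a b) (hb b)
    simp only [Fin.comp_snoc] at key
    rw [BoundedFormula.realize_all, BoundedFormula.toCont]
    constructor
    · intro h
      change (⨆ b : A.carrier, (A.value φ.toCont e (Fin.snoc a b) : ℝ)) ≤ δ
      exact ciSup_le fun b => (key b).1 (h (q b))
    · intro h
      push Not at h
      obtain ⟨b, hb⟩ := h
      -- A counterexample in `B` must be lifted to `A` to bound the supremum from below.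
      obtain ⟨b, rfl⟩ := hsurj b
      exact ((key b).2 hb).trans (A.value_le_value_sup e a φ.toCont b)

/-- The exact case `δ = 0`, `q = id` of the approximation lemma. -/
theorem ofClassical_value_toCont (M : Type w) [L.Structure M] [Nonempty M]
    (φ : L.BoundedFormula α n) (e : α → M) (a : Fin n → M) (h : φ.Realize e a) :
    (ofClassical L M).value φ.toCont e a = 0 := by
  classical
  have hd : ∀ a b : M, dist (α := (ofClassical L M).carrier) a b = if a = b then 0 else 1 :=
    fun _ _ => rfl
  have := (value_toCont_of_approx (ofClassical L M) (B := M) id Function.surjective_id le_rfl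
    (fun _ _ => rfl) (fun a b hab => ((hd a b).trans (if_pos hab)).le)
    (fun a b hab => by rw [sub_zero]; exact ((hd a b).trans (if_neg hab)).ge)
    (fun R a => ?_) φ e a 
      (congrArg Subtype.val (ofClassical_value_atomFuzziness M φ e a)).le).1 h
  · exact Subtype.ext (le_antisymm this (unitInterval.nonneg _))
  · have hR : (ofClassical L M).relMap (S := L.toMetricSignature) R a =
        if Structure.RelMap (M := M) R a then 0 else 1 := rfl
    rw [hR]
    change (_ → Structure.RelMap (M := M) R a) ∧ (_ → ¬ Structure.RelMap (M := M) R a)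
    by_cases hc : Structure.RelMap (M := M) R a <;> simp [hc]

/-! ### Finite classical structures from compact metric structures -/

/-- The sentence measuring how far the metric is from being `{0, 1}`-valued. -/
noncomputable def distFuzziness (S : MetricSignature.{u, v}) : ContSentence S :=
  .sup (.sup (.fuzziness (.dist (.var (.inr 0)) (.var (.inr 1)))))

theorem min_dist_le_value_distFuzziness {S : MetricSignature.{u, v}}
    (A : MetricStructure.{u, v, w} S) (a b : A.carrier) :
    min (dist a b) (1 - dist a b) ≤ A.sentenceValue (distFuzziness S) := by
  refine le_trans (le_of_eq ?_) ((A.value_le_value_sup Empty.elim (Fin.snoc Fin.elim0 a) _ b).trans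
    (A.value_le_value_sup Empty.elim Fin.elim0 _ a))
  rw [coe_value_fuzziness]
  rfl

theorem ofClassical_sentenceValue_distFuzziness (M : Type w) [L.Structure M] [Nonempty M] :
    (ofClassical L M).sentenceValue (distFuzziness L.toMetricSignature) = 0 := by
  have h := ofClassical_value_dist (L := L) (α := Empty) (n := 2) M (.var (.inr 0)) (.var (.inr 1))
  exact value_sup_eq_zero _ _ _ fun a => value_sup_eq_zero _ _ _ fun b =>
    value_fuzziness_eq_zero _ _ _ ((Classical.em _).imp (h _ _).1 (h _ _).2)

/-- A compact structure with nearly `{0, 1}`-valued metric has a finite classical quotient. -/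
theorem exists_finite_quotient (A : MetricStructure.{u, v, w} L.toMetricSignature)
    (hA : A.IsCompact) (hd : ∀ a b : A.carrier, min (dist a b) (1 - dist a b) ≤ 1 / 8) :
    ∃ (B : Type w) (_ : L.Structure B) (q : A.carrier → B), Function.Surjective q ∧ Finite B ∧
      (∀ {n : ℕ} (f : L.Functions n) (a : Fin n → A.carrier),
        q (A.funMap (S := L.toMetricSignature) f a) = Structure.funMap f (q ∘ a)) ∧
      (∀ a b, q a = q b ↔ dist a b ≤ 1 / 8) ∧
      ∀ {n : ℕ} (R : L.Relations n) (a : Fin n → A.carrier),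
        ((A.relMap (S := L.toMetricSignature) R a : ℝ) ≤ 1 / 8 →
          Structure.RelMap R (q ∘ a)) ∧
        (1 - 1 / 8 ≤ (A.relMap (S := L.toMetricSignature) R a : ℝ) →
          ¬ Structure.RelMap R (q ∘ a)) := by
  -- No distance lies strictly between `1/8` and `7/8`. This gives transitivity, since `1/8 + 1/8 <
  -- 7/8`.
  have near : ∀ a b : A.carrier, dist a b < 7 / 8 → dist a b ≤ 1 / 8 := fun a b h =>
    (min_le_iff.1 (hd a b)).elim id fun h' => by linarith
  let s : Setoid A.carrier :=
    { r := fun a b => dist a b ≤ 1 / 8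
      iseqv := ⟨fun a => by simp, fun {a b} h => by rwa [dist_comm],
        fun {a b c} h₁ h₂ => near _ _ (by linarith [dist_triangle a b c])⟩ }
  have hs : ∀ a b : A.carrier, Quotient.mk s a = Quotient.mk s b ↔ dist a b ≤ 1 / 8 :=
    fun a b => Quotient.eq
  -- The modulus needs a strict bound, so `1/8` is relaxed to `1/4`; changing representatives then
  -- moves every symbol's value by at most `1/4`.
  have hout : ∀ {n : ℕ} (a : Fin n → A.carrier),
      dist (fun i => (Quotient.mk s (a i)).out) a < 1 / 4 := fun a =>
    ((dist_pi_le_iff (by norm_num)).2 fun i => (hs _ _).1 (Quotient.out_eq _)).trans_lt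
      (by norm_num : (1 / 8 : ℝ) < 1 / 4)
  let ε : Ioc (0 : ℝ) 1 := ⟨1 / 4, by norm_num, by norm_num⟩
  let str : L.Structure (Quotient s) :=
    { funMap := fun f c => Quotient.mk s (A.funMap (S := L.toMetricSignature) f fun i => (c i).out)
      -- The threshold `1/2` tolerates this shift: `1/8 + 1/4 < 1/2 < 7/8 - 1/4`.
      RelMap := fun R c =>
        (A.relMap (S := L.toMetricSignature) R (fun i => (c i).out) : ℝ) < 1 / 2 }
  refine ⟨Quotient s, str, Quotient.mk s, Quotient.mk_surjective, ?_, ?_, hs, ?_⟩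
  · have : CompactSpace A.carrier := hA
    -- Each ball of radius `1/8` lies in the class of its centre, so the centres represent all
    -- classes.
    obtain ⟨t, -, ht, hcover⟩ := finite_cover_balls_of_compact
      (isCompact_univ (X := A.carrier)) (by norm_num : (0 : ℝ) < 1 / 8)
    have := ht.to_subtype
    refine Finite.of_surjective (fun a : t => Quotient.mk s a.1) fun c => ?_
    obtain ⟨b, rfl⟩ := Quotient.mk_surjective c
    obtain ⟨a, ha, hab⟩ := mem_iUnion₂.1 (hcover (mem_univ b))
    exact ⟨⟨a, ha⟩, (hs _ _).2 (by rw [dist_comm]; exact (Metric.mem_ball.1 hab).le)⟩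
  · intro n f a
    refine ((hs _ _).2 (near _ _ ?_)).symm
    have := A.funMap_modulus (S := L.toMetricSignature) f ε _ a (hout a)
    exact this.trans_lt (by norm_num [ε])
  · intro n R a
    have h := A.relMap_modulus (S := L.toMetricSignature) R ε _ a (hout a)
    have h' := abs_le.1 ((Subtype.dist_eq _ _).symm.trans_le h)
    change _ ≤ _ ∧ _ ≤ (1 / 4 : ℝ) at h'
    change (_ → (A.relMap (S := L.toMetricSignature) R
        (fun i => (Quotient.mk s (a i)).out) : ℝ) < 1 / 2) ∧
      (_ → ¬ (A.relMap (S := L.toMetricSignature) R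
        (fun i => (Quotient.mk s (a i)).out) : ℝ) < 1 / 2)
    have hε : (ε : ℝ) = 1 / 4 := rfl
    rw [hε] at h'
    exact ⟨fun _ => by linarith [h'.2], fun _ => by rw [not_lt]; linarith [h'.1]⟩

theorem Pseudocompact.classicallyPseudofinite {M : Type w} [L.Structure M] [Nonempty M]
    (h : (ofClassical L M).Pseudocompact) : ClassicallyPseudofinite L M := by
  intro σ hσ
  have hval : (ofClassical L M).sentenceValue
      ((distFuzziness L.toMetricSignature).max
        (σ.atomFuzziness.max σ.toCont)) = 0 := by
    refine value_max_eq_zero _ _ _ (ofClassical_sentenceValue_distFuzziness M)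
      (value_max_eq_zero _ _ _ (ofClassical_value_atomFuzziness M σ _ _)
        (ofClassical_value_toCont M σ _ _ ?_))
    exact (sentence_realize_iff σ _ _).1 hσ
  obtain ⟨A, hA, hlt⟩ := h.exists_sentenceValue_lt hval (by norm_num : (0 : ℝ) < 1 / 8)
  rw [sentenceValue, coe_value_max, coe_value_max, max_lt_iff, max_lt_iff] at hlt
  obtain ⟨hdist, hatom, hcont⟩ := hlt
  obtain ⟨B, _, q, hq, hfin, hfun, heq, hrel⟩ := exists_finite_quotient A hA fun a b =>
    (A.min_dist_le_value_distFuzziness a b).trans hdist.le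
  refine ⟨B, inferInstance, A.nonempty.map q, hfin, ?_⟩
  -- If `σ` failed in `B`, then `σ.toCont` would be at least `7/8` in `A`, yet it is below `1/8`.
  by_contra hB
  have := (value_toCont_of_approx A q hq (by norm_num) hfun (fun a b => (heq a b).1)
    (fun a b hab => ?_) hrel σ Empty.elim Fin.elim0 hatom.le).2 ?_
  · linarith
  · have hd := (A.min_dist_le_value_distFuzziness a b).trans hdist.le
    have := (min_le_iff.1 hd).resolve_left fun h' => hab ((heq a b).2 h')
    linarith
  · exact fun h => hB ((sentence_realize_iff σ _ _).2 h)

end MetricStructure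

theorem mainTheorem1 (L : FirstOrder.Language.{u, v}) (M : Type w) [L.Structure M] [Nonempty M] :
    List.TFAE
      [ClassicallyPseudofinite L M,
        (MetricStructure.ofClassical L M).Pseudofinite,
        (MetricStructure.ofClassical L M).StronglyPseudofinite,
        (MetricStructure.ofClassical L M).Pseudocompact,
        (MetricStructure.ofClassical L M).StronglyPseudocompact] := by
  tfae_have 1 → 3 := ClassicallyPseudofinite.stronglyPseudofinite
  tfae_have 3 → 2 := MetricStructure.StronglyPseudofinite.pseudofinite
  tfae_have 3 → 5 := MetricStructure.StronglyPseudofinite.stronglyPseudocompact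
  tfae_have 2 → 4 := MetricStructure.Pseudofinite.pseudocompact
  tfae_have 5 → 4 := MetricStructure.StronglyPseudocompact.pseudocompact
  tfae_have 4 → 1 := MetricStructure.Pseudocompact.classicallyPseudofinite
  tfae_finish
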